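/- Let $k$ be an algebraically closed field of prime characteristic $p$, let $k_0$ be an algebraically closed field of characteristic $0$ (for example an algebraic closure of the fraction field of the ring of Witt vectors $W(k)$), and let $H$ be a finite subgroup of $\mathrm{PGL}_2(k)$. Here $D_n$ denotes the dihedral group of order $2n$. There is an injective group homomorphism $H\to\mathrm{PGL}_2(k_0)$ if and only if one of the following holds: - $p$ does not divide $|H|$; - $p$ divides $|H|$, and $H$ is isomorphic to one of the following groups: - $\mathbb{Z}/p\mathbb{Z}$; - $D_p$, if $p\neq 2$; - the Klein four-group $V_4=(\mathbb{Z}/2\mathbb{Z})^2$ $(\cong D_2)$, the alternating group $\mathcal{A}_4$, or $D_n$ for some odd positive integer $n$, if $p=2$; - $\mathcal{A}_5$, if $p\leq 5$; - $\mathcal{A}_4$ or $\mathcal{S}_4$, if $p=3$. -/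

import Mathlib

open scoped MatrixGroups

/-!
Both directions rest on one classification, valid in every characteristic: over an algebraically
closed field `K`, a finite subgroup `H` of `PGL(2, K)` whose order is nonzero in `K` is cyclic,
dihedral, or isomorphic to `A₄`, `S₄` or `A₅` (`IsPolyhedral`,
`isPolyhedral_of_natCard_ne_zero`). Over an algebraically closed field of characteristic zero all
these groups do occur (`IsPolyhedral.exists_injective`). So an `H` of order prime to `p` embeds
into `PGL(2, k₀)`. Conversely, an `H` that embeds into `PGL(2, k₀)` is polyhedral, and if
`p` divides its order, then the list is cut down by the fact that an element of `PGL(2, k)` whose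
finite order is divisible by `p` is conjugate to a translation `z ↦ z + u`, hence has order exactly
`p` (`orderOf_eq_of_charP_dvd`).

The classification is Klein's, by counting on the projective line `OnePoint K`. A nontrivial
element of `H` is diagonalizable, so it has exactly two fixed points, and the stabilizer of a point
consists, once the point is moved to `∞`, of affine maps `z ↦ t z + u` determined by `t`, so it is
cyclic. From there on only finite group theory is used (`isPolyhedral_of_ncard_fixedBy`): the class
equation `∑ (1 - 1 / s) = 2 - 2 / |H|`, summed over the orbits of points with nontrivial stabilizer,
of order `s`, leaves a global fixed point or the types `(2, 2, m)`, `(2, 3, 3)`, `(2, 3, 4)` and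
`(2, 3, 5)`. The last three groups are recognized by their faithful actions on an orbit of four points, on the four
Sylow `3`-subgroups, and on the five Sylow `2`-subgroups.

In characteristic zero, dihedral groups are generated by homotheties and `z ↦ 1 / z`. To construct
`S₄` and `A₅` without a multiplication table, consider the group of all Möbius transformations
preserving the vertices of an octahedron or an icosahedron (`exists_polyhedral_subgroup`). It is
finite, and the classification identifies it, because it contains two noncommuting elements of order
four or five.
-/

/-! ### Dihedral groups -/

section Dihedral

variable {G : Type*} [Group G]

/-- A homomorphism from the cyclic group of order `n`, together with an involution `b` inverting
its values, extends to the dihedral group of order `2n`. -/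
def dihedralLift {n : ℕ} (φ : Multiplicative (ZMod n) →* G) (b : G) (hb : b * b = 1)
    (hφ : ∀ i, φ i * b = b * (φ i)⁻¹) : DihedralGroup n →* G where
  toFun
    | .r i => φ (.ofAdd i)
    | .sr i => b * φ (.ofAdd i)
  map_one' := by
    rw [DihedralGroup.one_def]
    exact map_one φ
  map_mul' x y := by
    have hb' (g : G) : b * (b * g) = g := by rw [← mul_assoc, hb, one_mul]
    rcases x with i | i <;> rcases y with j | j
    · simp
    · simp only [DihedralGroup.r_mul_sr, ← mul_assoc, hφ]
      rw [mul_assoc, ← map_inv, ← map_mul, sub_eq_neg_add]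
      rfl
    · simp [mul_assoc]
    · simp only [DihedralGroup.sr_mul_sr]
      rw [mul_assoc, ← mul_assoc (φ _), hφ, mul_assoc, hb', ← map_inv, ← map_mul, sub_eq_neg_add]
      rfl

theorem dihedralLift_injective {n : ℕ} {φ : Multiplicative (ZMod n) →* G} {b : G}
    (hb : b * b = 1) (hφ : ∀ i, φ i * b = b * (φ i)⁻¹) (hinj : Function.Injective φ)
    (hbφ : ∀ i, φ i ≠ b) : Function.Injective (dihedralLift φ b hb hφ) := by
  rw [injective_iff_map_eq_one]
  rintro (i | i) h
  · replace h : φ (.ofAdd i) = 1 := h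
    rw [map_eq_one_iff φ hinj, ofAdd_eq_one] at h
    rw [h, DihedralGroup.r_zero]
  · replace h : b * φ (.ofAdd i) = 1 := h
    refine absurd ?_ (hbφ (.ofAdd i)⁻¹)
    rw [map_inv, ← eq_inv_of_mul_eq_one_left h]

/-- A finite group with a cyclic subgroup of index two, all of whose elements outside that subgroup
square to one, is dihedral. -/
theorem nonempty_mulEquiv_dihedralGroup [Finite G] (C : Subgroup G) [IsCyclic C]
    (hC : C.index = 2) (hsq : ∀ g ∉ C, g * g = 1) :
    Nonempty (G ≃* DihedralGroup (Nat.card C)) := by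
  obtain ⟨b, hb⟩ : ∃ b, b ∉ C := by
    by_contra! h
    have : C = ⊤ := by ext; simp [h]
    simp [this] at hC
  let e := zmodCyclicMulEquiv (inferInstance : IsCyclic C)
  let φ : Multiplicative (ZMod (Nat.card C)) →* G := C.subtype.comp e.toMonoidHom
  have hφ (i) : φ i * b = b * (φ i)⁻¹ := by
    have h1 := hsq (b * φ i) fun h ↦ hb ((C.mul_mem_cancel_right (e i).2).1 h)
    have h2 := hsq b hb
    rw [← mul_right_inj b, ← mul_left_inj (φ i)]
    simpa only [mul_assoc, inv_mul_cancel, mul_one, h2] using h1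
  have hinj := dihedralLift_injective (hsq b hb) hφ (C.subtype_injective.comp e.injective)
    fun i h ↦ hb (h ▸ (e i).2)
  refine ⟨(MulEquiv.ofBijective _ ((Nat.bijective_iff_injective_and_card _).2 ⟨hinj, ?_⟩)).symm⟩
  rw [DihedralGroup.nat_card, ← C.index_mul_card, hC]

end Dihedral

/-! ### Embeddings into symmetric groups -/

section Perm

open MulAction

variable {G X : Type*} [Group G] [MulAction G X]

theorem exists_injective_perm_fin [FaithfulSMul G X] {n : ℕ} (hn : n ≠ 0) (hX : Nat.card X = n) :
    ∃ f : G →* Equiv.Perm (Fin n), Function.Injective f := by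
  have := Nat.finite_of_card_ne_zero (hX ▸ hn)
  let e := (Finite.equivFinOfCardEq hX).permCongrHom
  exact ⟨e.toMonoidHom.comp (toPermHom G X), e.injective.comp toPerm_injective⟩

theorem nonempty_mulEquiv_perm [FaithfulSMul G X] {n : ℕ} (hn : n ≠ 0) (hX : Nat.card X = n)
    (hG : Nat.card G = n.factorial) : Nonempty (G ≃* Equiv.Perm (Fin n)) := by
  obtain ⟨f, hf⟩ := exists_injective_perm_fin (G := G) hn hX
  refine ⟨MulEquiv.ofBijective f ((Nat.bijective_iff_injective_and_card _).2 ⟨hf, ?_⟩)⟩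
  rw [hG, Nat.card_perm, Nat.card_fin]

theorem nonempty_mulEquiv_alternatingGroup [FaithfulSMul G X] {n : ℕ} (hn : n ≠ 0)
    (hX : Nat.card X = n) (hG : 2 * Nat.card G = n.factorial) :
    Nonempty (G ≃* alternatingGroup (Fin n)) := by
  obtain ⟨f, hf⟩ := exists_injective_perm_fin (G := G) hn hX
  have h : f.range = alternatingGroup (Fin n) := by
    apply Equiv.Perm.eq_alternatingGroup_of_index_eq_two
    have h1 := f.range.card_mul_index
    rw [← Nat.card_congr (MonoidHom.ofInjective hf).toEquiv, Nat.card_perm, Nat.card_fin, ← hG,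
      mul_comm 2] at h1
    refine Nat.eq_of_mul_eq_mul_left (Nat.pos_of_ne_zero fun h0 ↦ ?_) h1
    exact n.factorial_ne_zero (by rw [← hG, h0])
  exact ⟨(MonoidHom.ofInjective hf).trans (MulEquiv.subgroupCongr h)⟩

end Perm

/-! ### Actions in which every nontrivial element has two fixed points -/

section TwoFixedPoints

open MulAction

variable {G X : Type*} [Group G] [MulAction G X]

theorem card_orbit_mul_card_stabilizer (w : X) :
    (orbit G w).ncard * Nat.card (stabilizer G w) = Nat.card G := by
  rw [← index_stabilizer, Subgroup.index_mul_card]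

theorem card_inf_stabilizer_smul (K : Subgroup G) [K.Normal] (h : G) (w : X) :
    Nat.card (K ⊓ stabilizer G (h • w) : Subgroup G) =
      Nat.card (K ⊓ stabilizer G w : Subgroup G) := by
  rw [Nat.card_congr ((K ⊓ stabilizer G w).equivMapOfInjective
    (MulAut.conj h).toMonoidHom (MulAut.conj h).injective).toEquiv,
    Subgroup.map_inf _ _ _ (MulAut.conj h).injective, ← stabilizer_smul_eq_stabilizer_map_conj,
    show K.map (MulAut.conj h).toMonoidHom = K from Subgroup.Normal.map_conj_eq K h]

theorem card_stabilizer_eq_of_mem_orbit {w x : X} (h : w ∈ orbit G x) :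
    Nat.card (stabilizer G w) = Nat.card (stabilizer G x) := by
  obtain ⟨g, rfl⟩ := h
  simpa using card_inf_stabilizer_smul ⊤ g x

open Classical in
/-- Double counting of the pairs of an element of `A` and a fixed point of it. -/
theorem sum_card_filter_smul_eq [Fintype X] (h2 : ∀ g : G, g ≠ 1 → (fixedBy X g).ncard = 2)
    (A : Finset G) (hA : 1 ∉ A) : ∑ w : X, (A.filter (· • w = w)).card = 2 * A.card := by
  rw [mul_comm, ← smul_eq_mul, ← Finset.sum_const]
  refine (Finset.sum_card_bipartiteAbove_eq_sum_card_bipartiteBelow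
    (fun (g : G) (w : X) ↦ g • w = w)).symm.trans (Finset.sum_congr rfl fun g hg ↦ ?_)
  rw [← h2 g (ne_of_mem_of_not_mem hg hA), Set.ncard_eq_toFinset_card', Finset.bipartiteAbove]
  congr 1
  ext
  simp

variable [Finite G]

open Classical in
omit [Finite G] in
theorem natCard_sub_one [Fintype G] (L : Subgroup G) :
    Nat.card L - 1 = (Finset.univ.filter fun g ↦ g ∈ L ∧ g ≠ 1).card := by
  rw [Nat.card_eq_fintype_card, Fintype.card_subtype, ← Finset.card_erase_of_mem (a := 1)]
  · congr 1
    ext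
    simp [and_comm]
  · simp

theorem sum_card_inf_stabilizer [Fintype X] (h2 : ∀ g : G, g ≠ 1 → (fixedBy X g).ncard = 2)
    (K : Subgroup G) :
    ∑ w : X, (Nat.card (K ⊓ stabilizer G w : Subgroup G) - 1) = 2 * (Nat.card K - 1) := by
  classical
  have := Fintype.ofFinite G
  rw [natCard_sub_one, ← sum_card_filter_smul_eq h2 _ (by simp)]
  refine Finset.sum_congr rfl fun w _ ↦ ?_
  rw [natCard_sub_one, Finset.filter_filter]
  congr 2
  ext g
  simp [Subgroup.mem_inf]
  tauto

variable [Finite X]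

theorem card_orbit_mul_le (h2 : ∀ g : G, g ≠ 1 → (fixedBy X g).ncard = 2) (K : Subgroup G)
    [K.Normal] (w : X) :
    (orbit G w).ncard * (Nat.card (K ⊓ stabilizer G w : Subgroup G) - 1) ≤
      2 * (Nat.card K - 1) := by
  classical
  have := Fintype.ofFinite X
  rw [← sum_card_inf_stabilizer (X := X) h2 K, ← smul_eq_mul, Set.ncard_eq_toFinset_card',
    ← Finset.sum_const]
  refine le_trans (le_of_eq (Finset.sum_congr rfl fun x hx ↦ ?_))
    (Finset.sum_le_sum_of_subset (Finset.subset_univ _))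
  rw [Set.mem_toFinset] at hx
  obtain ⟨g, rfl⟩ := hx
  rw [card_inf_stabilizer_smul]

/-- A normal subgroup containing a nontrivial element with a fixed point whose stabilizer has
prime order `q` contains all stabilizers of points in the orbit, and hence is large. -/
theorem card_mul_le_of_prime (h2 : ∀ g : G, g ≠ 1 → (fixedBy X g).ncard = 2) (K : Subgroup G)
    [K.Normal] {w : X} {q : ℕ} (hq : q.Prime) (hw : Nat.card (stabilizer G w) = q) {g : G}
    (hgK : g ∈ K) (hg : g ≠ 1) (hgw : g • w = w) :
    Nat.card G * (q - 1) ≤ 2 * (Nat.card K - 1) * q := by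
  have h1 : stabilizer G w ≤ K := by
    have := Fact.mk hq
    intro x hx
    obtain ⟨n, hn⟩ := Subgroup.mem_zpowers_iff.1 (mem_zpowers_of_prime_card
      (g := (⟨g, hgw⟩ : stabilizer G w)) (g' := ⟨x, hx⟩) hw (by simpa [Subtype.ext_iff] using hg))
    have h := congr_arg Subtype.val hn
    rw [SubgroupClass.coe_zpow] at h
    change g ^ n = x at h
    exact h ▸ K.zpow_mem hgK n
  have h3 := card_orbit_mul_le h2 K w
  rw [inf_eq_right.2 h1, hw] at h3
  rw [← card_orbit_mul_card_stabilizer (G := G) w, hw, mul_right_comm]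
  gcongr

/-- The class equation of the action: every orbit contributes `1 - 1 / s` where `s` is the order of
the stabilizer of a point in it. -/
theorem sum_one_sub_inv_card_stabilizer [Fintype (orbitRel.Quotient G X)]
    (h2 : ∀ g : G, g ≠ 1 → (fixedBy X g).ncard = 2) :
    ∑ ω : orbitRel.Quotient G X, (1 - 1 / (Nat.card (stabilizer G ω.out) : ℚ)) =
      2 - 2 / Nat.card G := by
  classical
  have := Fintype.ofFinite X
  have hG : (Nat.card G : ℚ) ≠ 0 := by exact_mod_cast Nat.card_pos.ne'
  have h1 : ∑ w : X, ((Nat.card (stabilizer G w) : ℚ) - 1) = 2 * (Nat.card G - 1) := by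
    have := sum_card_inf_stabilizer (X := X) h2 ⊤
    simp only [top_inf_eq, Subgroup.card_top] at this
    have h (n : ℕ) (hn : 0 < n) : (n : ℚ) - 1 = (n - 1 : ℕ) := by simp [Nat.cast_sub hn]
    rw [h _ Nat.card_pos, Finset.sum_congr rfl fun w _ ↦ h _ Nat.card_pos]
    exact_mod_cast this
  rw [← Finset.sum_fiberwise Finset.univ (fun w ↦ (Quotient.mk'' w : orbitRel.Quotient G X))] at h1
  rw [← mul_right_inj' hG, mul_sub, mul_div_cancel₀ _ hG, Finset.mul_sum]
  rw [mul_sub, mul_one, mul_comm] at h1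
  rw [← h1]
  refine Finset.sum_congr rfl fun ω _ ↦ ?_
  have hs : (Nat.card (stabilizer G ω.out) : ℚ) ≠ 0 := by exact_mod_cast Nat.card_pos.ne'
  have h3 : Finset.univ.filter (fun w : X ↦ (Quotient.mk'' w : orbitRel.Quotient G X) = ω) =
      (orbit G ω.out).toFinset := by
    ext w
    rw [Finset.mem_filter, Set.mem_toFinset, ← orbitRel_apply, ← Quotient.eq'', Quotient.out_eq']
    simp
  rw [h3, Finset.sum_congr rfl (g := fun _ ↦ (Nat.card (stabilizer G ω.out) : ℚ) - 1),
    Finset.sum_const, nsmul_eq_mul, ← Set.ncard_eq_toFinset_card',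
    ← card_orbit_mul_card_stabilizer (G := G) ω.out]
  · push_cast
    field_simp
  · intro w hw
    rw [card_stabilizer_eq_of_mem_orbit (Set.mem_toFinset.1 hw)]

theorem eq_of_inv_add_inv_add_inv {a b c n : ℕ} (ha : 2 ≤ a) (hab : a ≤ b) (hbc : b ≤ c)
    (hn : 0 < n) (h : (1 / a + 1 / b + 1 / c : ℚ) = 1 + 2 / n) :
    a = 2 ∧ (b = 2 ∧ n = 2 * c ∨ b = 3 ∧ (c = 3 ∧ n = 12 ∨ c = 4 ∧ n = 24 ∨ c = 5 ∧ n = 60)) := by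
  have hn' : (0 : ℚ) < 2 / n := by positivity
  have ha0 : (0 : ℚ) < a := by exact_mod_cast (by omega : 0 < a)
  have hb0 : (0 : ℚ) < b := by exact_mod_cast (by omega : 0 < b)
  have hba : (1 / b : ℚ) ≤ 1 / a := by gcongr
  have hcb : (1 / c : ℚ) ≤ 1 / b := by gcongr
  have ha3 : a < 3 := by
    by_contra! ha3
    have : (1 / a : ℚ) ≤ 1 / 3 := by gcongr; exact_mod_cast ha3
    linarith
  obtain rfl : a = 2 := by omega
  refine ⟨rfl, ?_⟩
  have hb4 : b < 4 := by
    by_contra! hb4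
    have : (1 / b : ℚ) ≤ 1 / 4 := by gcongr; exact_mod_cast hb4
    push_cast at *
    linarith
  interval_cases b
  · left
    have hc0 : (c : ℚ) ≠ 0 := by positivity
    have hn0 : (n : ℚ) ≠ 0 := by positivity
    refine ⟨rfl, ?_⟩
    field_simp at h
    have : (n : ℚ) = 2 * c := by push_cast at *; linarith
    exact_mod_cast this
  · right
    have hc6 : c < 6 := by
      by_contra! hc6
      have : (1 / c : ℚ) ≤ 1 / 6 := by gcongr; exact_mod_cast hc6
      push_cast at *
      linarith
    have hn0 : (n : ℚ) ≠ 0 := by positivity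
    have key (m : ℚ) (hm : (1 : ℚ) / c - 1 / 6 = 2 / m) (hm0 : m ≠ 0) : (n : ℚ) = m := by
      have : (2 : ℚ) / n = 2 / m := by push_cast at *; linarith
      field_simp at this
      exact this.symm
    refine ⟨rfl, ?_⟩
    interval_cases c
    · have := key 12 (by norm_num) (by norm_num); norm_cast at this; simp [this]
    · have := key 24 (by norm_num) (by norm_num); norm_cast at this; simp [this]
    · have := key 60 (by norm_num) (by norm_num); norm_cast at this; simp [this]

end TwoFixedPoints

/-! ### Recognition of the polyhedral groups -/

/-- A group isomorphic to one in Klein's list of rotation groups of the sphere: cyclic, dihedral of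
finite order, or the rotation group of a tetrahedron, of an octahedron or of an icosahedron. -/
def IsPolyhedral (G : Type*) [Group G] : Prop :=
  IsCyclic G ∨ (∃ n ≠ 0, Nonempty (G ≃* DihedralGroup n)) ∨
    Nonempty (G ≃* alternatingGroup (Fin 4)) ∨ Nonempty (G ≃* Equiv.Perm (Fin 4)) ∨
      Nonempty (G ≃* alternatingGroup (Fin 5))

section Recognition

open MulAction

variable {G X : Type*} [Group G] [MulAction G X] [Finite G] [Finite X]

/-- In the class equation every summand lies between `1 / 2` and `1 - 1 / |G|`, which leaves
room for exactly three of them. -/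
theorem exists_three_orbits (h2 : ∀ g : G, g ≠ 1 → (fixedBy X g).ncard = 2)
    (hbot : ∀ w : X, stabilizer G w ≠ ⊥) (htop : ∀ w : X, stabilizer G w ≠ ⊤) [Nontrivial G] :
    ∃ x y z : X, (∀ w, w ∈ orbit G x ∨ w ∈ orbit G y ∨ w ∈ orbit G z) ∧
      (1 / Nat.card (stabilizer G x) + 1 / Nat.card (stabilizer G y) +
        1 / Nat.card (stabilizer G z) : ℚ) = 1 + 2 / Nat.card G := by
  classical
  have := Fintype.ofFinite (orbitRel.Quotient G X)
  have hsum := sum_one_sub_inv_card_stabilizer (X := X) h2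
  have hn : (2 : ℚ) ≤ Nat.card G := by exact_mod_cast Finite.one_lt_card (α := G)
  have hs2 (w : X) : (2 : ℚ) ≤ Nat.card (stabilizer G w) := by
    exact_mod_cast (stabilizer G w).one_lt_card_iff_ne_bot.2 (hbot w)
  have hsn (w : X) : (Nat.card (stabilizer G w) : ℚ) < Nat.card G := by
    refine Nat.cast_lt.2 ((stabilizer G w).card_le_card_group.lt_of_ne fun h ↦ htop w ?_)
    exact Subgroup.eq_top_of_card_eq _ h
  have hlow : (Fintype.card (orbitRel.Quotient G X) : ℚ) * (1 / 2) ≤ 2 - 2 / Nat.card G := by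
    rw [← hsum, ← nsmul_eq_mul]
    refine Finset.card_nsmul_le_sum _ _ _ fun ω _ ↦ ?_
    have : (1 / Nat.card (stabilizer G ω.out) : ℚ) ≤ 1 / 2 := by gcongr; exact hs2 _
    linarith
  have hlt : Fintype.card (orbitRel.Quotient G X) < 4 := by
    have : (0 : ℚ) < 2 / Nat.card G := by positivity
    have : (Fintype.card (orbitRel.Quotient G X) : ℚ) < 4 := by linarith
    exact_mod_cast this
  have hgt : 2 < Fintype.card (orbitRel.Quotient G X) := by
    by_contra! hle
    have hn1 : (2 / Nat.card G : ℚ) = 2 * (1 / Nat.card G) := by ring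
    have hn2 : (1 / Nat.card G : ℚ) ≤ 1 / 2 := by gcongr
    rcases isEmpty_or_nonempty (orbitRel.Quotient G X) with h | h
    · rw [Fintype.sum_empty] at hsum
      linarith
    · have hle' : (Fintype.card (orbitRel.Quotient G X) : ℚ) ≤ 2 := by exact_mod_cast hle
      have := Finset.sum_lt_sum_of_nonempty (s := Finset.univ) Finset.univ_nonempty
        (f := fun ω : orbitRel.Quotient G X ↦ (1 - 1 / (Nat.card (stabilizer G ω.out) : ℚ)))
        (g := fun _ ↦ 1 - 1 / (Nat.card G : ℚ)) fun ω _ ↦ by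
          have := hs2 ω.out
          have : (1 / Nat.card G : ℚ) < 1 / Nat.card (stabilizer G ω.out) := by
            exact one_div_lt_one_div_of_lt (by linarith) (hsn _)
          linarith
      rw [hsum, Finset.sum_const, nsmul_eq_mul, Finset.card_univ] at this
      nlinarith
  obtain ⟨a, b, c, hab, hac, hbc, habc⟩ := Finset.card_eq_three.1
    (by rw [Finset.card_univ]; omega : (Finset.univ : Finset (orbitRel.Quotient G X)).card = 3)
  refine ⟨a.out, b.out, c.out, fun w ↦ ?_, ?_⟩
  · have hw : (Quotient.mk'' w : orbitRel.Quotient G X) ∈ ({a, b, c} : Finset _) := by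
      rw [← habc]
      exact Finset.mem_univ _
    simpa [← orbitRel_apply, ← Quotient.eq'', Quotient.out_eq'] using hw
  · rw [habc, Finset.sum_insert (by simp [hab, hac]), Finset.sum_pair hbc] at hsum
    linarith

/-- The numerical types of a finite group acting without a global fixed point: dihedral,
tetrahedral, octahedral and icosahedral. -/
theorem exists_orbits_of_type (h2 : ∀ g : G, g ≠ 1 → (fixedBy X g).ncard = 2)
    (hbot : ∀ w : X, stabilizer G w ≠ ⊥) (htop : ∀ w : X, stabilizer G w ≠ ⊤) [Nontrivial G] :
    ∃ x y z : X, (∀ w, w ∈ orbit G x ∨ w ∈ orbit G y ∨ w ∈ orbit G z) ∧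
      Nat.card (stabilizer G x) = 2 ∧
        (Nat.card (stabilizer G y) = 2 ∧ Nat.card G = 2 * Nat.card (stabilizer G z) ∨
          Nat.card (stabilizer G y) = 3 ∧
            (Nat.card (stabilizer G z) = 3 ∧ Nat.card G = 12 ∨
              Nat.card (stabilizer G z) = 4 ∧ Nat.card G = 24 ∨
                Nat.card (stabilizer G z) = 5 ∧ Nat.card G = 60)) := by
  have key (x y z : X) (hsum : (1 / Nat.card (stabilizer G x) + 1 / Nat.card (stabilizer G y) +
        1 / Nat.card (stabilizer G z) : ℚ) = 1 + 2 / Nat.card G)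
      (hxy : Nat.card (stabilizer G x) ≤ Nat.card (stabilizer G y))
      (hyz : Nat.card (stabilizer G y) ≤ Nat.card (stabilizer G z)) :=
    eq_of_inv_add_inv_add_inv ((stabilizer G x).one_lt_card_iff_ne_bot.2 (hbot x))
      hxy hyz Nat.card_pos hsum
  obtain ⟨x, y, z, hcov, hsum⟩ := exists_three_orbits h2 hbot htop
  rcases le_total (Nat.card (stabilizer G x)) (Nat.card (stabilizer G y)) with hxy | hxy <;>
  rcases le_total (Nat.card (stabilizer G y)) (Nat.card (stabilizer G z)) with hyz | hyz <;>
  rcases le_total (Nat.card (stabilizer G x)) (Nat.card (stabilizer G z)) with hxz | hxz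
  · exact ⟨x, y, z, hcov, key x y z hsum hxy hyz⟩
  · exact ⟨x, y, z, hcov, key x y z hsum hxy hyz⟩
  · exact ⟨x, z, y, fun w ↦ by have := hcov w; tauto, key x z y (by linarith) hxz hyz⟩
  · exact ⟨z, x, y, fun w ↦ by have := hcov w; tauto, key z x y (by linarith) hxz hxy⟩
  · exact ⟨y, x, z, fun w ↦ by have := hcov w; tauto, key y x z (by linarith) hxy hxz⟩
  · exact ⟨y, z, x, fun w ↦ by have := hcov w; tauto, key y z x (by linarith) hyz hxz⟩
  · exact ⟨z, y, x, fun w ↦ by have := hcov w; tauto, key z y x (by linarith) hyz hxy⟩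
  · exact ⟨z, y, x, fun w ↦ by have := hcov w; tauto, key z y x (by linarith) hyz hxy⟩

omit [Finite G] [Finite X] in
theorem exists_smul_eq_self (h2 : ∀ g : G, g ≠ 1 → (fixedBy X g).ncard = 2) {g : G} (hg : g ≠ 1) :
    ∃ w : X, g • w = w := by
  obtain ⟨w, hw⟩ := Set.nonempty_of_ncard_ne_zero (s := fixedBy X g) (by simp [h2 g hg])
  exact ⟨w, hw⟩

omit [Finite G] in
/-- A nontrivial element does not fix more than two points. -/
theorem eq_one_of_subset_fixedBy (h2 : ∀ g : G, g ≠ 1 → (fixedBy X g).ncard = 2) {g : G}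
    {s : Set X} (hs : s ⊆ fixedBy X g) (hs2 : 2 < s.ncard) : g = 1 := by
  by_contra hg
  have := Set.ncard_le_ncard hs
  rw [h2 g hg] at this
  omega

omit [Finite X] in
theorem nonempty_mulEquiv_dihedralGroup_of_stabilizer
    (h2 : ∀ g : G, g ≠ 1 → (fixedBy X g).ncard = 2) (x : X) [IsCyclic (stabilizer G x)]
    (hx : Nat.card G = 2 * Nat.card (stabilizer G x))
    (hw : ∀ w, w ∈ orbit G x ∨ Nat.card (stabilizer G w) = 2) :
    Nonempty (G ≃* DihedralGroup (Nat.card (stabilizer G x))) := by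
  have hi : (stabilizer G x).index = 2 := by
    have := (stabilizer G x).index_mul_card
    rw [hx] at this
    exact Nat.eq_of_mul_eq_mul_right Nat.card_pos this
  have := Subgroup.normal_of_index_eq_two hi
  refine nonempty_mulEquiv_dihedralGroup _ hi fun g hg ↦ ?_
  obtain ⟨w, hgw⟩ := exists_smul_eq_self (X := X) h2 (g := g) fun h ↦ hg (h ▸ one_mem _)
  rcases hw w with ⟨h, rfl⟩ | h
  · refine absurd ?_ hg
    have : g ∈ stabilizer G (h • x) := hgw
    rw [stabilizer_smul_eq_stabilizer_map_conj] at this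
    exact Subgroup.Normal.map_conj_eq (stabilizer G x) h ▸ this
  · rw [← pow_two, ← h]
    exact orderOf_dvd_iff_pow_eq_one.1 ((stabilizer G w).orderOf_dvd_natCard hgw)

omit [Finite G] in
theorem faithfulSMul_of_forall {Y : Type*} [MulAction G Y]
    (h : ∀ g : G, (∀ y : Y, g • y = y) → g = 1) : FaithfulSMul G Y where
  eq_of_smul_eq_smul {a b} hab := by
    rw [← inv_mul_eq_one]
    exact h _ fun y ↦ by rw [mul_smul, ← hab, inv_smul_smul]

omit [Finite G] in
/-- A group of type `(2, 3, 3)` acts faithfully on an orbit of four points. -/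
theorem nonempty_mulEquiv_alternatingGroup_four
    (h2 : ∀ g : G, g ≠ 1 → (fixedBy X g).ncard = 2) (x : X) (hx : Nat.card (stabilizer G x) = 3)
    (hG : Nat.card G = 12) : Nonempty (G ≃* alternatingGroup (Fin 4)) := by
  have ho := card_orbit_mul_card_stabilizer (G := G) x
  have ho4 : (orbit G x).ncard = 4 := by rw [hx, hG] at ho; omega
  have : FaithfulSMul G (orbit G x) := faithfulSMul_of_forall fun g hg ↦
    eq_one_of_subset_fixedBy (X := X) h2 (s := orbit G x)
      (fun w hw ↦ congr_arg Subtype.val (hg ⟨w, hw⟩)) (by omega)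
  exact nonempty_mulEquiv_alternatingGroup (X := orbit G x) (by norm_num) ho4 (by rw [hG]; rfl)

omit [Finite X] in
/-- The kernel of the action on the Sylow `p`-subgroups is contained in the normalizer of each of
them, and the index of this normalizer is their number. -/
theorem card_ker_toPermHom_sylow_dvd (p : ℕ) [Fact p.Prime] :
    Nat.card (toPermHom G (Sylow p G)).ker * Nat.card (Sylow p G) ∣ Nat.card G := by
  obtain ⟨P⟩ : Nonempty (Sylow p G) := inferInstance
  rw [P.card_eq_index_normalizer, ← (Subgroup.normalizer (P : Set G)).card_mul_index]
  refine Nat.mul_dvd_mul_right (Subgroup.card_dvd_of_le fun g hg ↦ ?_) _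
  rw [← Sylow.smul_eq_iff_mem_normalizer]
  exact congr_arg (fun f : Equiv.Perm (Sylow p G) ↦ f P) hg

/-- A group of type `(2, 3, 4)` acts faithfully on its four Sylow `3`-subgroups. -/
theorem nonempty_mulEquiv_perm_four (h2 : ∀ g : G, g ≠ 1 → (fixedBy X g).ncard = 2) {x y z : X}
    (hw : ∀ w, w ∈ orbit G x ∨ w ∈ orbit G y ∨ w ∈ orbit G z)
    (hx : Nat.card (stabilizer G x) = 2) (hy : Nat.card (stabilizer G y) = 3)
    (hz : Nat.card (stabilizer G z) = 4) (hG : Nat.card G = 24) :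
    Nonempty (G ≃* Equiv.Perm (Fin 4)) := by
  have : Fact (Nat.Prime 3) := ⟨Nat.prime_three⟩
  have hS {w : X} (hw : Nat.card (stabilizer G w) = 3) :
      ∃ P : Sylow 3 G, (P : Subgroup G) = stabilizer G w := by
    refine ⟨(IsPGroup.of_card (n := 1) hw).toSylow fun h ↦ ?_, rfl⟩
    have := (stabilizer G w).index_mul_card
    rw [hw, hG] at this
    change 3 ∣ (stabilizer G w).index at h
    omega
  have hcard : Nat.card (Sylow 3 G) = 4 := by
    obtain ⟨P, hP⟩ := hS hy
    have hd := P.card_dvd_index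
    have hi : (P : Subgroup G).index = 8 := by
      have := (stabilizer G y).index_mul_card
      rw [hy, hG] at this
      rw [hP]
      omega
    rw [hi] at hd
    have hm : _ % 3 = 1 % 3 := card_sylow_modEq_one 3 G
    have hle := Nat.le_of_dvd (by norm_num) hd
    -- a unique Sylow subgroup would fix all eight points of the orbit of `y`
    have h1 : Nat.card (Sylow 3 G) ≠ 1 := fun h1 ↦ by
      have := (Nat.card_eq_one_iff_unique.1 h1).1
      obtain ⟨g, hg, hg1⟩ := (stabilizer G y).bot_or_exists_ne_one.resolve_left fun h ↦ by
        simp [h] at hy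
      refine hg1 (eq_one_of_subset_fixedBy (X := X) h2 (s := orbit G y) (fun w hw ↦ ?_) ?_)
      · obtain ⟨Q, hQ⟩ := hS ((card_stabilizer_eq_of_mem_orbit hw).trans hy)
        rw [← hP, Subsingleton.elim P Q, hQ] at hg
        exact hg
      · have := card_orbit_mul_card_stabilizer (G := G) y
        rw [hy, hG] at this
        omega
    interval_cases h : Nat.card (Sylow 3 G) <;> omega
  have : FaithfulSMul G (Sylow 3 G) := by
    have hK := card_ker_toPermHom_sylow_dvd (G := G) 3
    rw [hcard, hG] at hK
    replace hK : Nat.card (toPermHom G (Sylow 3 G)).ker ∣ 6 :=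
      Nat.dvd_of_mul_dvd_mul_right (k := 4) (by norm_num) hK
    refine faithfulSMul_of_forall fun g hg ↦ ?_
    have hgK : g ∈ (toPermHom G (Sylow 3 G)).ker := Equiv.ext hg
    have hKn : (toPermHom G (Sylow 3 G)).ker.Normal := inferInstance
    generalize (toPermHom G (Sylow 3 G)).ker = K at hK hgK hKn
    have hK6 := Nat.le_of_dvd (by norm_num) hK
    by_contra hg1
    -- `K` is too small to contain the stabilizer of order two or three of a point
    have h23 {w : X} {g : G} (hgK : g ∈ K) (hg1 : g ≠ 1) (hgw : g • w = w) :
        Nat.card (stabilizer G w) = 4 := by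
      rcases hw w with h | h | h
      · have := card_mul_le_of_prime h2 K Nat.prime_two
          ((card_stabilizer_eq_of_mem_orbit h).trans hx) hgK hg1 hgw
        omega
      · have := card_mul_le_of_prime h2 K Nat.prime_three
          ((card_stabilizer_eq_of_mem_orbit h).trans hy) hgK hg1 hgw
        omega
      · exact (card_stabilizer_eq_of_mem_orbit h).trans hz
    obtain ⟨w, hgw⟩ := exists_smul_eq_self (X := X) h2 hg1
    have hcw := h23 hgK hg1 hgw
    have ho := card_orbit_mul_card_stabilizer (G := G) w
    have ho6 : (orbit G w).ncard = 6 := by rw [hcw, hG] at ho; omega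
    have hle := card_orbit_mul_le h2 K w
    have hlt : 1 < Nat.card (K ⊓ stabilizer G w : Subgroup G) :=
      (Subgroup.one_lt_card_iff_ne_bot _).2 fun h ↦
        hg1 (Subgroup.mem_bot.1 (h ▸ ⟨hgK, hgw⟩ : g ∈ (⊥ : Subgroup G)))
    have hK4 : 4 ≤ Nat.card K := by
      rw [ho6] at hle
      omega
    have hK3 : 3 ∣ Nat.card K := by
      interval_cases Nat.card K <;> omega
    obtain ⟨⟨a, haK⟩, ha⟩ := exists_prime_orderOf_dvd_card' 3 hK3
    rw [Subgroup.orderOf_mk] at ha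
    have ha1 : a ≠ 1 := fun h ↦ by simp [h] at ha
    obtain ⟨v, hav⟩ := exists_smul_eq_self (X := X) h2 ha1
    have := (stabilizer G v).orderOf_dvd_natCard hav
    rw [ha, h23 haK ha1 hav] at this
    omega
  exact nonempty_mulEquiv_perm (X := Sylow 3 G) (by norm_num) hcard (by rw [hG]; rfl)

omit [Finite X] in
/-- The centralizer of an involution permutes its two fixed points, so if the stabilizer of any of
these has order two, then it has order at most four. -/
theorem card_centralizer_le_four (h2 : ∀ g : G, g ≠ 1 → (fixedBy X g).ncard = 2) {t : G}
    (ht : t ≠ 1) {w : X} (htw : t • w = w) (hw : Nat.card (stabilizer G w) = 2) :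
    Nat.card (Subgroup.centralizer {t}) ≤ 4 := by
  rw [← card_orbit_mul_card_stabilizer (G := Subgroup.centralizer {t}) w]
  refine (Nat.mul_le_mul ?_ ?_ : _ ≤ 2 * 2)
  · rw [← h2 t ht]
    refine Set.ncard_le_ncard ?_ (Set.finite_of_ncard_ne_zero (by simp [h2 t ht]))
    rintro _ ⟨⟨g, hg⟩, rfl⟩
    change t • g • w = g • w
    rw [← mul_smul, ← Subgroup.mem_centralizer_singleton_iff.1 hg, mul_smul, htw]
  · rw [← hw]
    exact Nat.card_le_card_of_injective (fun g ↦ (⟨g.1.1, g.2⟩ : stabilizer G w)) fun a b h ↦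
      Subtype.ext (Subtype.ext (congr_arg (fun s : stabilizer G w ↦ s.1) h))

/-- In the icosahedral case the fifteen involutions are partitioned by the Sylow `2`-subgroups into
sets of three. -/
theorem card_sylow_two_eq_five (h2 : ∀ g : G, g ≠ 1 → (fixedBy X g).ncard = 2) {x y z : X}
    (hw : ∀ w, w ∈ orbit G x ∨ w ∈ orbit G y ∨ w ∈ orbit G z)
    (hx : Nat.card (stabilizer G x) = 2) (hy : Nat.card (stabilizer G y) = 3)
    (hz : Nat.card (stabilizer G z) = 5) (hG : Nat.card G = 60) :
    Nat.card (Sylow 2 G) = 5 := by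
  classical
  have : Fact (Nat.Prime 2) := ⟨Nat.prime_two⟩
  have := Fintype.ofFinite G
  have := Fintype.ofFinite X
  have := Fintype.ofFinite (Sylow 2 G)
  have hS (S : Sylow 2 G) : Nat.card S = 4 := by
    rw [S.card_eq_multiplicity, hG, Nat.factorization_def _ Nat.prime_two,
      show 60 = 2 ^ 2 * 15 from rfl, padicValNat.mul (by norm_num) (by norm_num),
      padicValNat.prime_pow, padicValNat.eq_zero_of_not_dvd (by norm_num)]
    rfl
  have heven {w : X} (h : 2 ∣ Nat.card (stabilizer G w)) :
      w ∈ orbit G x ∧ Nat.card (stabilizer G w) = 2 := by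
    rcases hw w with h' | h' | h' <;> have h'' := card_stabilizer_eq_of_mem_orbit h'
    · exact ⟨h', h''.trans hx⟩
    · omega
    · omega
  have hinv {t : G} (ht1 : t ≠ 1) (ht : t * t = 1) {w : X} (htw : t • w = w) :
      w ∈ orbit G x ∧ Nat.card (stabilizer G w) = 2 := by
    refine heven ?_
    have h : orderOf t = 2 := orderOf_eq_prime (by rw [pow_two, ht]) ht1
    rw [← h]
    exact Subgroup.orderOf_dvd_natCard _ htw
  have hSinv {S : Sylow 2 G} {t : G} (ht : t ∈ S) : t * t = 1 := by
    by_cases ht1 : t = 1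
    · simp [ht1]
    obtain ⟨w, htw⟩ := exists_smul_eq_self (X := X) h2 ht1
    have hd1 := (S : Subgroup G).orderOf_dvd_natCard ht
    have hd2 := (stabilizer G w).orderOf_dvd_natCard htw
    have h1 : orderOf t ≠ 1 := by simpa using ht1
    replace hd1 : orderOf t ∣ 4 := hS S ▸ hd1
    have hle := Nat.le_of_dvd (by norm_num) hd1
    have h2' : 2 ∣ orderOf t := by
      generalize orderOf t = m at hd1 h1 hle
      interval_cases m <;> omega
    have := (heven (h2'.trans hd2)).2
    rw [this] at hd2
    rw [← pow_two]
    exact orderOf_dvd_iff_pow_eq_one.1 hd2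
  have hSeq {S : Sylow 2 G} {t : G} (ht1 : t ≠ 1) (ht : t ∈ S) :
      (S : Subgroup G) = Subgroup.centralizer {t} := by
    obtain ⟨w, htw⟩ := exists_smul_eq_self (X := X) h2 ht1
    refine Subgroup.eq_of_le_of_card_ge (fun s hs ↦ ?_) ((card_centralizer_le_four h2 ht1 htw
      (hinv ht1 (hSinv ht) htw).2).trans (hS S).ge)
    rw [Subgroup.mem_centralizer_singleton_iff]
    have h1 := hSinv (S.mul_mem hs ht)
    have h2 := hSinv hs
    have h3 := hSinv ht
    rw [← inv_eq_of_mul_eq_one_right h1, mul_inv_rev, inv_eq_of_mul_eq_one_right h2,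
      inv_eq_of_mul_eq_one_right h3]
  -- count the involutions by their fixed points, and then by the Sylow subgroups
  let U : Finset G := Finset.univ.filter fun t ↦ t ≠ 1 ∧ t * t = 1
  have hU1 : 2 * U.card = 30 := by
    rw [← sum_card_filter_smul_eq (X := X) h2 U (by simp [U])]
    have ho : (orbit G x).toFinset.card = 30 := by
      have := card_orbit_mul_card_stabilizer (G := G) x
      rw [hx, hG] at this
      rw [← Set.ncard_eq_toFinset_card']
      omega
    rw [← ho, Finset.card_eq_sum_ones, ← Finset.sum_subset (Finset.subset_univ _)]
    · refine Finset.sum_congr rfl fun w hw ↦ ?_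
      have hw2 := (card_stabilizer_eq_of_mem_orbit (Set.mem_toFinset.1 hw)).trans hx
      rw [show 1 = Nat.card (stabilizer G w) - 1 by rw [hw2], natCard_sub_one]
      congr 1
      ext t
      have htw (htw : t • w = w) : t * t = 1 := by
        rw [← pow_two, ← hw2]
        exact orderOf_dvd_iff_pow_eq_one.1 ((stabilizer G w).orderOf_dvd_natCard htw)
      simp only [U, Finset.mem_filter, Finset.mem_univ, true_and, mem_stabilizer_iff]
      tauto
    · intro w _ hwx
      rw [Finset.card_eq_zero, Finset.filter_eq_empty_iff]
      intro t ht htw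
      simp only [U, Finset.mem_filter] at ht
      exact hwx (Set.mem_toFinset.2 (hinv ht.2.1 ht.2.2 htw).1)
  have hU2 : U.card = Fintype.card (Sylow 2 G) * 3 := by
    have := Finset.sum_card_bipartiteAbove_eq_sum_card_bipartiteBelow
      (fun (t : G) (S : Sylow 2 G) ↦ t ∈ S) (s := U) (t := Finset.univ)
    rw [Finset.sum_const_nat (m := 1), Finset.sum_const_nat (m := 3), mul_one] at this
    · exact this
    · intro S _
      rw [show 3 = Nat.card (S : Subgroup G) - 1 by rw [hS S], natCard_sub_one]
      congr 1
      ext t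
      have := @hSinv S t
      simp only [U, Finset.bipartiteBelow, Finset.mem_filter, Finset.mem_univ, true_and]
      change _ ↔ t ∈ S ∧ _
      tauto
    · intro t ht
      simp only [U, Finset.mem_filter] at ht
      have hp : IsPGroup 2 (Subgroup.zpowers t) :=
        .of_card (n := 1) (by
          rw [Nat.card_zpowers, orderOf_eq_prime (by rw [pow_two, ht.2.2]) ht.2.1, pow_one])
      obtain ⟨S, hSt⟩ := hp.exists_le_sylow
      refine Finset.card_eq_one.2 ⟨S, ?_⟩
      have htS : t ∈ S := hSt (Subgroup.mem_zpowers t)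
      ext Q
      simp only [Finset.bipartiteAbove, Finset.mem_filter, Finset.mem_univ, true_and,
        Finset.mem_singleton]
      exact ⟨fun h ↦ Sylow.ext ((hSeq ht.2.1 h).trans (hSeq ht.2.1 htS).symm), fun h ↦ h ▸ htS⟩
  rw [Nat.card_eq_fintype_card]
  omega

/-- A group of type `(2, 3, 5)` acts faithfully on its five Sylow `2`-subgroups. -/
theorem nonempty_mulEquiv_alternatingGroup_five
    (h2 : ∀ g : G, g ≠ 1 → (fixedBy X g).ncard = 2) {x y z : X}
    (hw : ∀ w, w ∈ orbit G x ∨ w ∈ orbit G y ∨ w ∈ orbit G z)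
    (hx : Nat.card (stabilizer G x) = 2) (hy : Nat.card (stabilizer G y) = 3)
    (hz : Nat.card (stabilizer G z) = 5) (hG : Nat.card G = 60) :
    Nonempty (G ≃* alternatingGroup (Fin 5)) := by
  have : Fact (Nat.Prime 2) := ⟨Nat.prime_two⟩
  have hcard := card_sylow_two_eq_five h2 hw hx hy hz hG
  have : FaithfulSMul G (Sylow 2 G) := by
    have hK := card_ker_toPermHom_sylow_dvd (G := G) 2
    rw [hcard, hG] at hK
    replace hK : Nat.card (toPermHom G (Sylow 2 G)).ker ∣ 12 :=
      Nat.dvd_of_mul_dvd_mul_right (k := 5) (by norm_num) hK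
    have hK12 := Nat.le_of_dvd (by norm_num) hK
    refine faithfulSMul_of_forall fun g hg ↦ ?_
    have hgK : g ∈ (toPermHom G (Sylow 2 G)).ker := Equiv.ext hg
    -- the kernel is too small to contain all stabilizers of points in an orbit
    by_contra hg1
    obtain ⟨w, hgw⟩ := exists_smul_eq_self (X := X) h2 hg1
    rcases hw w with h | h | h
    · have := card_mul_le_of_prime h2 _ Nat.prime_two
        ((card_stabilizer_eq_of_mem_orbit h).trans hx) hgK hg1 hgw
      omega
    · have := card_mul_le_of_prime h2 _ Nat.prime_three
        ((card_stabilizer_eq_of_mem_orbit h).trans hy) hgK hg1 hgw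
      omega
    · have := card_mul_le_of_prime h2 _ Nat.prime_five
        ((card_stabilizer_eq_of_mem_orbit h).trans hz) hgK hg1 hgw
      omega
  exact nonempty_mulEquiv_alternatingGroup (X := Sylow 2 G) (by norm_num) hcard (by rw [hG]; rfl)

omit [Finite G] [Finite X] in
theorem isCyclic_of_stabilizer_eq_top {w : X} (hcyc : IsCyclic (stabilizer G w))
    (hw : stabilizer G w = ⊤) : IsCyclic G := by
  rw [hw] at hcyc
  exact isCyclic_of_surjective _ Subgroup.topEquiv.surjective

theorem isPolyhedral_of_forall_stabilizer_ne_bot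
    (h2 : ∀ g : G, g ≠ 1 → (fixedBy X g).ncard = 2)
    (hcyc : ∀ w : X, IsCyclic (stabilizer G w)) (hbot : ∀ w : X, stabilizer G w ≠ ⊥) :
    IsPolyhedral G := by
  rcases subsingleton_or_nontrivial G with hG | hG
  · exact .inl inferInstance
  by_cases htop : ∃ w : X, stabilizer G w = ⊤
  · obtain ⟨w, hw⟩ := htop
    exact .inl (isCyclic_of_stabilizer_eq_top (hcyc w) hw)
  push Not at htop
  obtain ⟨x, y, z, hw, hx, ⟨hy, hG⟩ | ⟨hy, ⟨hz, hG⟩ | ⟨hz, hG⟩ | ⟨hz, hG⟩⟩⟩ :=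
    exists_orbits_of_type h2 hbot htop
  · refine .inr (.inl ⟨_, Nat.card_pos.ne', nonempty_mulEquiv_dihedralGroup_of_stabilizer h2 z hG
      fun w ↦ ?_⟩)
    rcases hw w with h | h | h
    · exact .inr ((card_stabilizer_eq_of_mem_orbit h).trans hx)
    · exact .inr ((card_stabilizer_eq_of_mem_orbit h).trans hy)
    · exact .inl h
  · exact .inr (.inr (.inl (nonempty_mulEquiv_alternatingGroup_four h2 z hz hG)))
  · exact .inr (.inr (.inr (.inl (nonempty_mulEquiv_perm_four h2 hw hx hy hz hG))))
  · exact .inr (.inr (.inr (.inr (nonempty_mulEquiv_alternatingGroup_five h2 hw hx hy hz hG))))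

omit [Finite X] in
/-- A finite group acting on a set with cyclic stabilizers, such that each nontrivial element has
exactly two fixed points, is polyhedral. -/
theorem isPolyhedral_of_ncard_fixedBy
    (h2 : ∀ g : G, g ≠ 1 → (fixedBy X g).ncard = 2)
    (hcyc : ∀ w : X, IsCyclic (stabilizer G w)) : IsPolyhedral G := by
  -- only the finitely many points with nontrivial stabilizer matter
  let Y : SubMulAction G X :=
    { carrier := {w | ∃ g : G, g ≠ 1 ∧ g • w = w}
      smul_mem' := by
        rintro h w ⟨g, hg, hgw⟩
        refine ⟨h * g * h⁻¹, by simpa using hg, ?_⟩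
        rw [mul_smul, inv_smul_smul, mul_smul, hgw] }
  have hY : Finite Y := by
    have : (Y : Set X) ⊆ ⋃ g ∈ {g : G | g ≠ 1}, fixedBy X g := by
      rintro w ⟨g, hg, hgw⟩
      exact Set.mem_biUnion hg hgw
    exact (Set.Finite.subset (Set.Finite.biUnion (Set.toFinite _) fun g hg ↦
      Set.finite_of_ncard_ne_zero (by simp [h2 g hg])) this).to_subtype
  have hst (w : Y) : stabilizer G w = stabilizer G (w : X) := by
    ext g
    simp [Subtype.ext_iff]
  refine isPolyhedral_of_forall_stabilizer_ne_bot (X := Y) (fun g hg ↦ ?_)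
    (fun w ↦ hst w ▸ hcyc w) fun w h ↦ ?_
  · rw [← h2 g hg, ← Set.ncard_image_of_injective _ Subtype.val_injective]
    congr 1
    ext w
    simp only [Set.mem_image, mem_fixedBy, Subtype.ext_iff]
    constructor
    · rintro ⟨v, hv, rfl⟩
      exact hv
    · exact fun hw ↦ ⟨⟨w, g, hg, hw⟩, hw, rfl⟩
  · obtain ⟨g, hg, hgw⟩ := w.2
    exact hg (Subgroup.mem_bot.1 (h ▸ (hst w ▸ hgw : g ∈ stabilizer G w)))

end Recognition

/-! ### Möbius transformations -/

section Moebius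

open MulAction Matrix OnePoint

variable {K : Type*} [Field K]

/-- The Möbius transformation `z ↦ (a z + b) / (c z + d)`. -/
noncomputable def moebius (a b c d : K) (h : a * d - b * c ≠ 0) : PGL(2, K) :=
  .mk (GeneralLinearGroup.mkOfDetNeZero !![a, b; c, d] (by rwa [det_fin_two_of]))

theorem exists_eq_moebius (g : PGL(2, K)) : ∃ a b c d h, g = moebius a b c d h := by
  obtain ⟨A, rfl⟩ := ProjGenLinGroup.mk_surjective g
  refine ⟨A 0 0, A 0 1, A 1 0, A 1 1, by simpa [det_fin_two] using A.det_ne_zero, ?_⟩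
  rw [moebius]
  congr 1
  ext i j
  fin_cases i <;> fin_cases j <;> rfl

/-- The affine map `z ↦ t z + u`. -/
noncomputable def affine (t : Kˣ) (u : K) : PGL(2, K) := moebius t u 0 1 (by simp)

theorem affine_mul (t t' : Kˣ) (u u' : K) :
    affine t u * affine t' u' = affine (t * t') (t * u' + u) := by
  rw [affine, affine, affine, moebius, moebius, moebius, ← map_mul]
  congr 1
  ext i j
  fin_cases i <;> fin_cases j <;> simp [mul_apply, Fin.sum_univ_two]

theorem affine_one : affine (1 : Kˣ) 0 = 1 := by
  rw [affine, moebius, ← map_one ProjGenLinGroup.mk]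
  congr 1
  ext i j
  fin_cases i <;> fin_cases j <;> simp

theorem affine_zero_pow (t : Kˣ) (n : ℕ) : affine t 0 ^ n = affine (t ^ n) 0 := by
  induction n with
  | zero => simp [affine_one]
  | succ n ih => rw [pow_succ, ih, affine_mul, pow_succ]; simp

theorem affine_inv (t : Kˣ) (u : K) : (affine t u)⁻¹ = affine t⁻¹ (-(↑t⁻¹ * u)) := by
  rw [inv_eq_iff_mul_eq_one, affine_mul, ← affine_one]
  simp

variable [DecidableEq K]

/-- The action of `PGL(2, K)` on the projective line by Möbius transformations. -/
instance mulActionOnePoint : MulAction PGL(2, K) (OnePoint K) :=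
  ProjGenLinGroup.mulActionOfGL fun u a ↦ by
    cases a <;> simp [smul_infty_eq_ite, smul_some_eq_ite]

theorem moebius_smul_infty (a b c d : K) (h) :
    moebius a b c d h • (∞ : OnePoint K) = if c = 0 then ∞ else ↑(a / c) :=
  smul_infty_eq_ite _

theorem moebius_smul_coe (a b c d : K) (h) (z : K) :
    moebius a b c d h • (z : OnePoint K) =
      if c * z + d = 0 then ∞ else ↑((a * z + b) / (c * z + d)) :=
  smul_some_eq_ite

theorem affine_smul_infty (t : Kˣ) (u : K) : affine t u • (∞ : OnePoint K) = ∞ := by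
  simp [affine, moebius_smul_infty]

theorem affine_smul_coe (t : Kˣ) (u z : K) :
    affine t u • (z : OnePoint K) = ↑(t * z + u) := by
  simp [affine, moebius_smul_coe]

theorem affine_inj {t t' : Kˣ} {u u' : K} : affine t u = affine t' u' ↔ t = t' ∧ u = u' := by
  refine ⟨fun h ↦ ?_, fun ⟨h, h'⟩ ↦ by rw [h, h']⟩
  have h0 := congr_arg (· • ((0 : K) : OnePoint K)) h
  have h1 := congr_arg (· • ((1 : K) : OnePoint K)) h
  simp only [affine_smul_coe, OnePoint.coe_eq_coe] at h0 h1
  have hu : u = u' := by simpa using h0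
  refine ⟨Units.ext ?_, hu⟩
  simpa [hu] using h1

theorem smul_infty_eq_infty_iff {g : PGL(2, K)} :
    g • (∞ : OnePoint K) = ∞ ↔ ∃ t u, g = affine t u := by
  refine ⟨fun hg ↦ ?_, fun ⟨t, u, h⟩ ↦ h ▸ affine_smul_infty t u⟩
  obtain ⟨a, b, c, d, h, rfl⟩ := exists_eq_moebius g
  have hc : c = 0 := by
    by_contra hc
    simp [moebius_smul_infty, hc] at hg
  subst hc
  have had : a * d ≠ 0 := by simpa using h
  have hd := right_ne_zero_of_mul had
  refine ⟨Units.mk0 (a / d) (div_ne_zero (left_ne_zero_of_mul had) hd), b / d, ?_⟩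
  rw [affine, moebius, moebius, eq_comm, ProjGenLinGroup.mk_eq_mk_iff]
  refine ⟨Units.mk0 d hd, ?_⟩
  ext i j
  fin_cases i <;> fin_cases j <;> simp [mul_apply, Fin.sum_univ_two, hd]

theorem affine_one_pow (u : K) (n : ℕ) : affine 1 u ^ n = affine 1 (n * u) := by
  induction n with
  | zero => simp [affine_one]
  | succ n ih =>
    rw [pow_succ, ih, affine_mul, affine_inj, Nat.cast_succ, Units.val_one]
    exact ⟨one_mul 1, by ring⟩

theorem exists_smul_infty_eq (w : OnePoint K) : ∃ h : PGL(2, K), h • (∞ : OnePoint K) = w := by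
  cases w with
  | infty => exact ⟨1, one_smul _ _⟩
  | coe z => exact ⟨moebius z 1 1 0 (by simp), by simp [moebius_smul_infty]⟩

theorem exists_conj_eq_affine {g : PGL(2, K)} {w : OnePoint K} (hg : g • w = w) :
    ∃ h t u, g = h * affine t u * h⁻¹ := by
  obtain ⟨h, rfl⟩ := exists_smul_infty_eq w
  obtain ⟨t, u, htu⟩ := smul_infty_eq_infty_iff.1
    (by rw [mul_smul, mul_smul, hg, inv_smul_smul] : (h⁻¹ * g * h) • (∞ : OnePoint K) = ∞)
  exact ⟨h, t, u, by rw [← htu]; group⟩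

/-- Jordan normal form of a Möbius transformation. -/
theorem exists_conj_eq_translation_or_homothety {g : PGL(2, K)} {w : OnePoint K}
    (hg : g • w = w) :
    ∃ h, (∃ u, g = h * affine 1 u * h⁻¹) ∨ ∃ t : Kˣ, t ≠ 1 ∧ g = h * affine t 0 * h⁻¹ := by
  obtain ⟨h, t, u, rfl⟩ := exists_conj_eq_affine hg
  by_cases ht : t = 1
  · exact ⟨h, .inl ⟨u, by rw [ht]⟩⟩
  · have ht' : (1 - t : K) ≠ 0 := sub_ne_zero.2 fun h ↦ ht (Units.ext h.symm)
    -- the translation moves the origin to the second fixed point of `z ↦ t z + u`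
    refine ⟨h * affine 1 (u / (1 - t)), .inr ⟨t, ht, ?_⟩⟩
    have : affine t u = affine 1 (u / (1 - t)) * affine t 0 * (affine 1 (u / (1 - t)))⁻¹ := by
      rw [affine_inv, affine_mul, affine_mul, affine_inj]
      refine ⟨by simp, ?_⟩
      simp
      field_simp
      ring
    rw [this]
    group

theorem exists_smul_onePoint_eq_self [IsAlgClosed K] (g : PGL(2, K)) :
    ∃ w : OnePoint K, g • w = w := by
  obtain ⟨a, b, c, d, h, rfl⟩ := exists_eq_moebius g
  by_cases hc : c = 0
  · exact ⟨∞, by simp [moebius_smul_infty, hc]⟩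
  · obtain ⟨z, hz⟩ := IsAlgClosed.exists_root
      (Polynomial.C c * Polynomial.X ^ 2 + Polynomial.C (d - a) * Polynomial.X +
        Polynomial.C (-b)) (by rw [Polynomial.degree_quadratic hc]; norm_num)
    simp only [Polynomial.IsRoot, Polynomial.eval_add, Polynomial.eval_mul, Polynomial.eval_C,
      Polynomial.eval_pow, Polynomial.eval_X] at hz
    refine ⟨z, ?_⟩
    have hden : c * z + d ≠ 0 := fun h0 ↦ h (by
      linear_combination (a - c * z) * h0 + c * hz)
    rw [moebius_smul_coe, if_neg hden, OnePoint.coe_eq_coe, div_eq_iff hden]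
    linear_combination -hz

theorem ncard_fixedBy_conj (h g : PGL(2, K)) :
    (fixedBy (OnePoint K) (h * g * h⁻¹)).ncard = (fixedBy (OnePoint K) g).ncard := by
  rw [← smul_fixedBy, Set.ncard_smul_set]

theorem fixedBy_affine_zero {t : Kˣ} (ht : t ≠ 1) :
    fixedBy (OnePoint K) (affine t 0) = {∞, ((0 : K) : OnePoint K)} := by
  ext w
  cases w with
  | infty => simp [affine_smul_infty]
  | coe z =>
    have ht' : (t : K) - 1 ≠ 0 := sub_ne_zero.2 fun h ↦ ht (Units.ext h)
    simp only [mem_fixedBy, affine_smul_coe, add_zero, OnePoint.coe_eq_coe, Set.mem_insert_iff,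
      OnePoint.coe_ne_infty, Set.mem_singleton_iff, false_or]
    rw [← sub_eq_zero, ← sub_one_mul, mul_eq_zero, or_iff_right ht']

theorem eq_one_of_smul_eq_self {g : PGL(2, K)} {z : K} (hz : z ≠ 0)
    (h : g • (∞ : OnePoint K) = ∞) (h0 : g • ((0 : K) : OnePoint K) = (0 : K))
    (hgz : g • (z : OnePoint K) = z) : g = 1 := by
  obtain ⟨t, u, rfl⟩ := smul_infty_eq_infty_iff.1 h
  rw [affine_smul_coe, OnePoint.coe_eq_coe] at h0 hgz
  have hu : u = 0 := by simpa using h0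
  rw [← affine_one, affine_inj]
  refine ⟨Units.ext ?_, hu⟩
  simpa [hu, hz] using hgz

variable [IsAlgClosed K]

/-- An element of finite order prime to the characteristic is not conjugate to a translation. -/
theorem ncard_fixedBy_eq_two {g : PGL(2, K)} (hg : g ≠ 1) {n : ℕ} (hn : (n : K) ≠ 0)
    (hgn : g ^ n = 1) : (fixedBy (OnePoint K) g).ncard = 2 := by
  obtain ⟨w, hw⟩ := exists_smul_onePoint_eq_self g
  obtain ⟨h, ⟨u, rfl⟩ | ⟨t, ht, rfl⟩⟩ := exists_conj_eq_translation_or_homothety hw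
  · rw [conj_pow, conj_eq_one_iff, affine_one_pow, ← affine_one, affine_inj] at hgn
    have hu : u = 0 := by simpa [hn] using hgn.2
    exact absurd (by rw [hu, affine_one, conj_eq_one_iff]) hg
  · rw [ncard_fixedBy_conj, fixedBy_affine_zero ht, Set.ncard_pair (by simp)]

/-- An element of finite order divisible by the characteristic is conjugate to a translation. -/
theorem orderOf_eq_of_charP_dvd (p : ℕ) [Fact p.Prime] [CharP K p] {g : PGL(2, K)}
    (hg : orderOf g ≠ 0) (hp : p ∣ orderOf g) : orderOf g = p := by
  obtain ⟨w, hw⟩ := exists_smul_onePoint_eq_self g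
  have hp0 := (Fact.out : p.Prime)
  obtain ⟨h, ⟨u, hu⟩ | ⟨t, ht, hg'⟩⟩ := exists_conj_eq_translation_or_homothety hw
  · refine orderOf_eq_prime ?_ fun h1 ↦ ?_
    · rw [hu, conj_pow, conj_eq_one_iff, affine_one_pow, CharP.cast_eq_zero, zero_mul, affine_one]
    · rw [h1, orderOf_one] at hp
      exact hp0.one_lt.ne' (Nat.dvd_one.1 hp)
  · obtain ⟨m, hm⟩ := hp
    have hpow := pow_orderOf_eq_one g
    -- the Frobenius endomorphism is injective, so a root of unity has order prime to `p`
    have htm : t ^ m = 1 := by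
      rw [hg', conj_pow, conj_eq_one_iff, affine_zero_pow, ← affine_one, affine_inj, ← hg', hm,
        mul_comm, pow_mul] at hpow
      refine Units.ext (frobenius_inj K p ?_)
      simpa [frobenius_def, Units.ext_iff] using hpow.1
    have hgm : g ^ m = 1 := by
      rw [hg', conj_pow, conj_eq_one_iff, affine_zero_pow, htm, affine_one]
    have hm0 : 0 < m := Nat.pos_of_ne_zero fun h0 ↦ hg (by rw [hm, h0, mul_zero])
    have := Nat.le_of_dvd hm0 (orderOf_dvd_of_pow_eq_one hgm)
    rw [hm] at this
    nlinarith [hp0.two_le]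

omit [IsAlgClosed K] in
/-- A finite group of Möbius transformations of order prime to the characteristic which fixes a
point is cyclic: moving the point to `∞`, it consists of affine maps `z ↦ t z + u`, and there are no
nontrivial translations in it, so that it embeds into `Kˣ` by taking `t`. -/
theorem isCyclic_stabilizer (H : Subgroup PGL(2, K)) [Finite H] (hH : (Nat.card H : K) ≠ 0)
    (w : OnePoint K) : IsCyclic (stabilizer H w) := by
  obtain ⟨h, rfl⟩ := exists_smul_infty_eq w
  have key (s : stabilizer H (h • (∞ : OnePoint K))) :
      ∃ t u, (s.1.1 : PGL(2, K)) = h * affine t u * h⁻¹ := by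
    have hs : s.1.1 • h • (∞ : OnePoint K) = h • ∞ := s.2
    obtain ⟨t, u, htu⟩ := smul_infty_eq_infty_iff.1
      (by rw [mul_smul, mul_smul, hs, inv_smul_smul] : (h⁻¹ * s.1.1 * h) • (∞ : OnePoint K) = ∞)
    exact ⟨t, u, by rw [← htu]; group⟩
  choose t u htu using key
  have hinj {t t' : Kˣ} {u u' : K} (h' : h * affine t u * h⁻¹ = h * affine t' u' * h⁻¹) :
      t = t' ∧ u = u' := by
    rwa [mul_left_inj, mul_right_inj, affine_inj] at h'
  let f : stabilizer H (h • (∞ : OnePoint K)) →* K :=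
    (Units.coeHom K).comp (MonoidHom.mk' t fun a b ↦ by
      refine (hinj (u := u (a * b)) (u' := t a * u b + u a) ?_).1
      rw [← htu, ← affine_mul, Subgroup.coe_mul, Subgroup.coe_mul, htu, htu]
      group)
  refine isCyclic_of_injective_ringHom f ((injective_iff_map_eq_one f).2 fun s hs ↦ ?_)
  have ht : t s = 1 := Units.ext hs
  have hpow : s.1.1 ^ Nat.card H = 1 := by
    rw [← SubgroupClass.coe_pow, pow_card_eq_one', Subgroup.coe_one]
  rw [htu, ht, conj_pow, conj_eq_one_iff, affine_one_pow, ← affine_one, affine_inj] at hpow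
  have hu : u s = 0 := by simpa [hH] using hpow.2
  refine Subtype.ext (Subtype.ext ?_)
  rw [htu, ht, hu, affine_one]
  simp

/-- Klein's classification of the finite groups of Möbius transformations, in the case of order
prime to the characteristic. -/
theorem isPolyhedral_of_natCard_ne_zero (H : Subgroup PGL(2, K)) [Finite H]
    (hH : (Nat.card H : K) ≠ 0) : IsPolyhedral H := by
  refine isPolyhedral_of_ncard_fixedBy (X := OnePoint K) (fun g hg ↦ ?_) (isCyclic_stabilizer H hH)
  exact ncard_fixedBy_eq_two (g := g.1) (by simpa using hg) hH
    (by rw [← SubgroupClass.coe_pow, pow_card_eq_one', Subgroup.coe_one])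

end Moebius

/-! ### Polyhedral groups of Möbius transformations -/

section Embedding

open scoped Pointwise
open MulAction Matrix OnePoint Polynomial

theorem IsPolyhedral.of_mulEquiv {G G' : Type*} [Group G] [Group G'] (h : IsPolyhedral G)
    (e : G ≃* G') : IsPolyhedral G' := by
  rcases h with h | ⟨n, hn, ⟨h⟩⟩ | ⟨⟨h⟩⟩ | ⟨⟨h⟩⟩ | ⟨⟨h⟩⟩
  · exact .inl (isCyclic_of_surjective e e.surjective)
  · exact .inr (.inl ⟨n, hn, ⟨e.symm.trans h⟩⟩)
  · exact .inr (.inr (.inl ⟨e.symm.trans h⟩))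
  · exact .inr (.inr (.inr (.inl ⟨e.symm.trans h⟩)))
  · exact .inr (.inr (.inr (.inr ⟨e.symm.trans h⟩)))

/-- In cyclic and dihedral groups, elements of the same order `m ≥ 3` commute. -/
theorem IsPolyhedral.of_not_commute {G : Type*} [Group G] (h : IsPolyhedral G) {m : ℕ}
    (hm : 3 ≤ m) {a b : G} (ha : orderOf a = m) (hb : orderOf b = m) (hab : a * b ≠ b * a) :
    Nonempty (G ≃* alternatingGroup (Fin 4)) ∨ Nonempty (G ≃* Equiv.Perm (Fin 4)) ∨
      Nonempty (G ≃* alternatingGroup (Fin 5)) := by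
  rcases h with h | ⟨n, hn, ⟨e⟩⟩ | h
  · exact absurd (h.isMulCommutative.is_comm.comm a b) hab
  · -- reflections have order two, and rotations commute
    rw [← e.orderOf_eq] at ha hb
    rw [Ne, ← e.injective.eq_iff, map_mul, map_mul] at hab
    generalize e a = x at *
    generalize e b = y at *
    rcases x with i | i
    · rcases y with j | j
      · rw [DihedralGroup.r_mul_r, DihedralGroup.r_mul_r, add_comm] at hab
        exact absurd rfl hab
      · rw [DihedralGroup.orderOf_sr] at hb
        omega
    · rw [DihedralGroup.orderOf_sr] at ha
      omega
  · exact h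

set_option maxRecDepth 10000 in
theorem pow_two_eq_one_of_sign_eq_one_fin_four :
    ∀ g : Equiv.Perm (Fin 4), Equiv.Perm.sign g = 1 → g ^ 4 = 1 → g ^ 2 = 1 := by
  decide

set_option maxRecDepth 10000 in
theorem pow_two_eq_one_of_sign_eq_one_fin_five :
    ∀ g : Equiv.Perm (Fin 5), Equiv.Perm.sign g = 1 → g ^ 4 = 1 → g ^ 2 = 1 := by
  decide

variable {K : Type*} [Field K]

/-- The homothety `z ↦ t z`, as a homomorphism in `t`. -/
noncomputable def homothety (K : Type*) [Field K] : Kˣ →* PGL(2, K) :=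
  .mk' (fun t ↦ affine t 0) fun t t' ↦ by simp [affine_mul]

theorem homothety_injective : Function.Injective (homothety K) := by
  classical
  exact fun t t' h ↦ (affine_inj.1 h).1

variable [DecidableEq K]

theorem eq_of_forall_smul_onePoint_eq {g g' : PGL(2, K)}
    (h : ∀ w : OnePoint K, g • w = g' • w) : g = g' := by
  rw [← inv_mul_eq_one]
  refine eq_one_of_smul_eq_self one_ne_zero ?_ ?_ ?_ <;> rw [mul_smul, ← h, inv_smul_smul]

variable [IsAlgClosed K] [CharZero K]

variable (K) in
theorem exists_injective_dihedralGroup {n : ℕ} (hn : n ≠ 0) :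
    ∃ f : DihedralGroup n →* PGL(2, K), Function.Injective f := by
  have := NeZero.mk hn
  have hcard := HasEnoughRootsOfUnity.natCard_rootsOfUnity K n
  let e := zmodCyclicMulEquiv (inferInstance : IsCyclic (rootsOfUnity n K))
  rw [hcard] at e
  let φ : Multiplicative (ZMod n) →* PGL(2, K) :=
    (homothety K).comp ((rootsOfUnity n K).subtype.comp e.toMonoidHom)
  have hφ (i) : ∃ t, φ i = affine t 0 := ⟨_, rfl⟩
  let b : PGL(2, K) := moebius 0 1 1 0 (by simp)
  have hb : b * b = 1 := by
    refine eq_of_forall_smul_onePoint_eq fun w ↦ ?_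
    cases w with
    | infty => simp [b, mul_smul, moebius_smul_infty, moebius_smul_coe]
    | coe z => by_cases hz : z = 0 <;> simp [b, mul_smul, moebius_smul_infty, moebius_smul_coe, hz]
  refine ⟨dihedralLift φ b hb fun i ↦ ?_, dihedralLift_injective _ _
    (homothety_injective.comp (Subtype.val_injective.comp e.injective)) fun i h ↦ ?_⟩
  · obtain ⟨t, ht⟩ := hφ i
    rw [ht]
    refine eq_of_forall_smul_onePoint_eq fun w ↦ ?_
    cases w with
    | infty => simp [b, mul_smul, moebius_smul_infty, affine_smul_coe, affine_inv,
        affine_smul_infty]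
    | coe z =>
      by_cases hz : z = 0 <;>
        simp [b, mul_smul, moebius_smul_coe, affine_smul_coe, affine_inv, affine_smul_infty, hz,
          mul_comm]
  · obtain ⟨t, ht⟩ := hφ i
    replace h := congr_arg (· • (∞ : OnePoint K)) h
    simp [ht, b, affine_smul_infty, moebius_smul_infty] at h

/-- The point at infinity together with the zeros of a polynomial. -/
def zerosWithInfty (f : K[X]) : Set (OnePoint K) := insert ∞ ((↑) '' {z : K | f.IsRoot z})

omit [DecidableEq K] [IsAlgClosed K] [CharZero K] in
theorem finite_zerosWithInfty {f : K[X]} (hf : f ≠ 0) : (zerosWithInfty f).Finite :=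
  ((finite_setOfPred_isRoot hf).image _).insert _

/-- The stabilizer of a finite subset of the projective line is a finite group as soon as that set
has three points. If it contains two noncommuting elements of the same order `m`, then it is one of
the three exceptional groups. -/
theorem exists_polyhedral_subgroup {f : K[X]} (hf : f ≠ 0) (hf0 : f.IsRoot 0) {m : ℕ} (hm : 3 ≤ m)
    {ζ : Kˣ} (hζ : orderOf ζ = m) (hζf : ∀ z, f.IsRoot z → f.IsRoot (ζ * z)) {S : PGL(2, K)}
    (hS : ∀ v ∈ zerosWithInfty f, S • v ∈ zerosWithInfty f) {s w : K} (hw : w ≠ 0)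
    (hs : S • (s : OnePoint K) = ∞) (hsw : S • ((ζ * s : K) : OnePoint K) = w) :
    ∃ H : Subgroup PGL(2, K), (∃ a : H, orderOf a = m) ∧
      (Nonempty (H ≃* alternatingGroup (Fin 4)) ∨ Nonempty (H ≃* Equiv.Perm (Fin 4)) ∨
        Nonempty (H ≃* alternatingGroup (Fin 5))) := by
  have hV := finite_zerosWithInfty hf
  have hmem (g : PGL(2, K)) (hg : ∀ v ∈ zerosWithInfty f, g • v ∈ zerosWithInfty f) :
      g ∈ stabilizer PGL(2, K) (zerosWithInfty f) := by
    exact (mem_stabilizer_set' hV).2 fun v hv ↦ hg v hv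
  have hT : ∀ v ∈ zerosWithInfty f, affine ζ 0 • v ∈ zerosWithInfty f := by
    rintro _ (rfl | ⟨z, hz, rfl⟩)
    · exact .inl (affine_smul_infty _ _)
    · exact .inr ⟨_, hζf z hz, by rw [affine_smul_coe, add_zero]⟩
  let T' : stabilizer PGL(2, K) (zerosWithInfty f) := ⟨affine ζ 0, hmem _ hT⟩
  let S' : stabilizer PGL(2, K) (zerosWithInfty f) := ⟨S, hmem _ hS⟩
  have hsinv : S⁻¹ • (∞ : OnePoint K) = s := by rw [← hs, inv_smul_smul]
  have hSTS : (S * affine ζ 0 * S⁻¹) • (∞ : OnePoint K) = w := by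
    rw [mul_smul, mul_smul, hsinv, affine_smul_coe, add_zero, hsw]
  have hwV : f.IsRoot w := by
    have : (w : OnePoint K) ∈ zerosWithInfty f := by
      rw [← hSTS, ← (S' * T' * S'⁻¹).2]
      exact Set.smul_mem_smul_set (.inl rfl)
    simpa [zerosWithInfty] using this
  have : Finite (stabilizer PGL(2, K) (zerosWithInfty f)) := by
    have := hV.to_subtype
    refine Finite.of_injective
      (fun g (v : zerosWithInfty f) ↦ (⟨g.1 • v.1, ?_⟩ : zerosWithInfty f)) fun g g' h ↦ ?_
    · exact (mem_stabilizer_set.1 g.2 v).2 v.2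
    · have key (v : OnePoint K) (hv : v ∈ zerosWithInfty f) : (g⁻¹ * g').1 • v = v := by
        have : g.1 • v = g'.1 • v := congr_arg Subtype.val (congr_fun h ⟨v, hv⟩)
        rw [Subgroup.coe_mul, mul_smul, ← this, Subgroup.coe_inv, inv_smul_smul]
      rw [← inv_mul_eq_one]
      exact Subtype.ext (eq_one_of_smul_eq_self hw (key _ (.inl rfl))
        (key _ (.inr ⟨0, hf0, rfl⟩)) (key _ (.inr ⟨w, hwV, rfl⟩)))
  have hT' : orderOf T' = m := by
    rw [← hζ, ← orderOf_injective _ homothety_injective, ← Subgroup.orderOf_coe]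
    rfl
  refine ⟨stabilizer PGL(2, K) (zerosWithInfty f), ⟨T', hT'⟩, ?_⟩
  refine (isPolyhedral_of_natCard_ne_zero _ (by exact_mod_cast Nat.card_pos.ne')).of_not_commute
    hm hT' (b := S' * T' * S'⁻¹) ?_ fun h ↦ hw ?_
  · rw [← hT']
    exact (MulAut.conj S').orderOf_eq T'
  · replace h := congr_arg (fun g ↦ g.1 • (∞ : OnePoint K)) h
    replace h : affine ζ 0 • (S * affine ζ 0 * S⁻¹) • (∞ : OnePoint K) =
      (S * affine ζ 0 * S⁻¹) • affine ζ 0 • (∞ : OnePoint K) := by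
      simp only [← mul_smul]
      exact h
    rw [affine_smul_infty, hSTS, affine_smul_coe, OnePoint.coe_eq_coe, add_zero,
      ← sub_eq_zero, ← sub_one_mul, mul_eq_zero, sub_eq_zero, Units.val_eq_one] at h
    refine h.resolve_left fun h1 ↦ ?_
    rw [h1, orderOf_one] at hζ
    omega

variable (K)

/-- The vertices `∞, 0, ±1, ±i` of an octahedron are preserved by `z ↦ i z` and by
`z ↦ (z + 1) / (1 - z)`. -/
theorem exists_injective_perm_four :
    ∃ f : Equiv.Perm (Fin 4) →* PGL(2, K), Function.Injective f := by
  obtain ⟨ζ, hζ⟩ := HasEnoughRootsOfUnity.exists_primitiveRoot K 4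
  have hζ4 := hζ.pow_eq_one
  have hζ2 : ζ ^ 2 = -1 := by
    have h : ζ ^ 2 ≠ 1 := hζ.pow_ne_one_of_pos_of_lt (by norm_num) (by norm_num)
    have : (ζ ^ 2 - 1) * (ζ ^ 2 + 1) = 0 := by linear_combination hζ4
    exact eq_neg_of_add_eq_zero_left ((mul_eq_zero.1 this).resolve_left (sub_ne_zero.2 h))
  have hζ1 : 1 - ζ ≠ 0 := fun h ↦ two_ne_zero (α := K) (by linear_combination (1 + ζ) * h + hζ2)
  have hζ1' : ζ + 1 ≠ 0 := fun h ↦ two_ne_zero (α := K) (by linear_combination (1 - ζ) * h + hζ2)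
  let f : K[X] := X ^ 5 - X
  have hf : f ≠ 0 := fun h ↦ by
    have := congr_arg (eval (2 : K)) h
    norm_num [f] at this
  have hroot (z : K) : f.IsRoot z ↔ z ^ 5 - z = 0 := by simp [f, IsRoot]
  have hdet : (1 : K) * 1 - 1 * (-1) ≠ 0 := by norm_num
  have hS : ∀ v ∈ zerosWithInfty f, moebius 1 1 (-1) 1 hdet • v ∈ zerosWithInfty f := by
    rintro _ (rfl | ⟨z, hz, rfl⟩)
    · rw [moebius_smul_infty, if_neg (by norm_num)]
      exact .inr ⟨_, (hroot _).2 (by norm_num), rfl⟩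
    · rw [moebius_smul_coe]
      split_ifs with h
      · exact .inl rfl
      · refine .inr ⟨_, (hroot _).2 ?_, rfl⟩
        have hz' := (hroot z).1 hz
        simp only [neg_one_mul, one_mul] at h ⊢
        have hF : (z + 1) ^ 5 * (-z + 1) - (z + 1) * (-z + 1) ^ 5 = 0 := by
          linear_combination (-8) * hz'
        have := div_eq_zero_iff.2 (.inl hF : _ ∨ (-z + 1) ^ 6 = 0)
        rw [← this]
        field_simp
  obtain ⟨H, ⟨a, ha⟩, h⟩ := exists_polyhedral_subgroup (m := 4) hf ((hroot 0).2 (by norm_num))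
    (by norm_num) (ζ := (hζ.isUnit (by norm_num)).unit)
    (by rw [← orderOf_units]; exact hζ.eq_orderOf.symm)
    (fun z hz ↦ by
      rw [hroot] at hz ⊢
      rw [IsUnit.unit_spec]
      linear_combination ζ * hz + (ζ * z ^ 5) * hζ4)
    hS (s := 1) (div_ne_zero hζ1' hζ1) (by simp [moebius_smul_coe])
    (by
      rw [IsUnit.unit_spec, moebius_smul_coe, if_neg fun h ↦ hζ1 (by linear_combination h)]
      congr 2 <;> ring)
  -- an even permutation of four or five letters does not have order four
  have hpow {n : ℕ} (h4 : ∀ g : Equiv.Perm (Fin n), Equiv.Perm.sign g = 1 → g ^ 4 = 1 → g ^ 2 = 1)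
      (e : H ≃* alternatingGroup (Fin n)) : False := by
    have h2 : orderOf (e a).1 ∣ 2 := orderOf_dvd_of_pow_eq_one (h4 _ (e a).2 (by
      rw [← ha, ← e.orderOf_eq, ← Subgroup.orderOf_coe, pow_orderOf_eq_one]))
    rw [Subgroup.orderOf_coe, e.orderOf_eq, ha] at h2
    omega
  rcases h with ⟨⟨e⟩⟩ | ⟨⟨e⟩⟩ | ⟨⟨e⟩⟩
  · exact (hpow pow_two_eq_one_of_sign_eq_one_fin_four e).elim
  · exact ⟨H.subtype.comp e.symm.toMonoidHom, H.subtype_injective.comp e.symm.injective⟩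
  · exact (hpow pow_two_eq_one_of_sign_eq_one_fin_five e).elim

omit [DecidableEq K] [IsAlgClosed K] [CharZero K] in
variable {K} in
/-- Klein's form `x ^ 11 * y + 11 * x ^ 6 * y ^ 6 - x * y ^ 11`, whose zeros are the vertices of a
regular icosahedron, is multiplied by a constant under a substitution of order two. -/
theorem icosahedral_form_semiinvariant {φ : K} (hφ : φ ^ 2 = φ + 1) (z : K) :
    (-φ * z + 1) ^ 11 * (z + φ) + 11 * (-φ * z + 1) ^ 6 * (z + φ) ^ 6 -
      (-φ * z + 1) * (z + φ) ^ 11 = 125 * (8 * φ + 5) * (z ^ 11 + 11 * z ^ 6 - z) := by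
  grind

/-- The vertices of an icosahedron, which are `∞` and the zeros of `z ^ 11 + 11 * z ^ 6 - z`, are
preserved by `z ↦ ζ z` for `ζ ^ 5 = 1` and by `z ↦ (-φ z + 1) / (z + φ)` with the golden ratio
`φ`. -/
theorem exists_injective_alternatingGroup_five :
    ∃ f : alternatingGroup (Fin 5) →* PGL(2, K), Function.Injective f := by
  obtain ⟨ζ, hζ⟩ := HasEnoughRootsOfUnity.exists_primitiveRoot K 5
  have hζ5 := hζ.pow_eq_one
  have hζ1 : 1 - ζ ≠ 0 := sub_ne_zero.2 (hζ.ne_one (by norm_num)).symm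
  -- `φ` is the golden ratio
  obtain ⟨φ, hφ⟩ : ∃ φ : K, φ ^ 2 = φ + 1 := by
    obtain ⟨φ, h⟩ := IsAlgClosed.exists_root (C 1 * X ^ 2 + C (-1) * X + C (-1) : K[X])
      (by rw [degree_quadratic one_ne_zero]; norm_num)
    refine ⟨φ, ?_⟩
    simp only [IsRoot, eval_add, eval_mul, eval_C, eval_pow, eval_X] at h
    linear_combination h
  have hφ0 : φ ≠ 0 := fun h ↦ by simp [h] at hφ
  let f : K[X] := X ^ 11 + 11 * X ^ 6 - X
  have hroot (z : K) : f.IsRoot z ↔ z ^ 11 + 11 * z ^ 6 - z = 0 := by simp [f, IsRoot]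
  have hf : f ≠ 0 := fun h ↦ by
    have := (hroot 1).1 (by rw [h]; simp [IsRoot])
    norm_num at this
  have hdet : -φ * φ - 1 * 1 ≠ 0 := fun h ↦ by
    have : (5 : K) = 0 := by grind
    norm_num at this
  have hw : φ ^ 2 * ζ + 1 ≠ 0 := fun h ↦ by
    have : (25 : K) = 0 := by grind
    norm_num at this
  have hS : ∀ v ∈ zerosWithInfty f, moebius (-φ) 1 1 φ hdet • v ∈ zerosWithInfty f := by
    rintro _ (rfl | ⟨z, hz, rfl⟩)
    · rw [moebius_smul_infty, if_neg one_ne_zero]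
      exact .inr ⟨_, (hroot _).2 (by grind), rfl⟩
    · rw [moebius_smul_coe]
      split_ifs with h
      · exact .inl rfl
      · refine .inr ⟨_, (hroot _).2 ?_, rfl⟩
        have hz' := (hroot z).1 hz
        rw [one_mul] at h ⊢
        have hF := icosahedral_form_semiinvariant hφ z
        rw [hz', mul_zero] at hF
        have := div_eq_zero_iff.2 (.inl hF : _ ∨ (z + φ) ^ 12 = 0)
        rw [← this]
        field_simp
  obtain ⟨H, ⟨a, ha⟩, h⟩ := exists_polyhedral_subgroup (m := 5) hf ((hroot 0).2 (by norm_num))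
    (by norm_num) (ζ := (hζ.isUnit (by norm_num)).unit)
    (by rw [← orderOf_units]; exact hζ.eq_orderOf.symm)
    (fun z hz ↦ by
      rw [hroot] at hz ⊢
      rw [IsUnit.unit_spec]
      linear_combination ζ * hz +
        (ζ * (ζ ^ 5 + 1) * z ^ 11 + 11 * ζ * z ^ 6) * hζ5)
    hS (s := -φ) (div_ne_zero hw (mul_ne_zero hφ0 hζ1)) (by simp [moebius_smul_coe])
    (by
      rw [IsUnit.unit_spec, moebius_smul_coe, if_neg fun h ↦ mul_ne_zero hφ0 hζ1 (by
        linear_combination h)]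
      congr 2 <;> ring)
  have hdvd : 5 ∣ Nat.card H := ha ▸ orderOf_dvd_natCard a
  rcases h with ⟨⟨e⟩⟩ | ⟨⟨e⟩⟩ | ⟨⟨e⟩⟩
  · have := two_mul_nat_card_alternatingGroup (α := Fin 4)
    rw [← Nat.card_congr e.toEquiv, Nat.card_perm, Nat.card_fin, show Nat.factorial 4 = 24 from rfl]
      at this
    omega
  · rw [Nat.card_congr e.toEquiv, Nat.card_perm, Nat.card_fin, show Nat.factorial 4 = 24 from rfl]
      at hdvd
    omega
  · exact ⟨H.subtype.comp e.symm.toMonoidHom, H.subtype_injective.comp e.symm.injective⟩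

theorem IsPolyhedral.exists_injective {G : Type*} [Group G] [Finite G] (h : IsPolyhedral G) :
    ∃ f : G →* PGL(2, K), Function.Injective f := by
  have key {G' : Type} [Group G'] (e : G ≃* G') {f : G' →* PGL(2, K)}
      (hf : Function.Injective f) : ∃ f : G →* PGL(2, K), Function.Injective f :=
    ⟨f.comp e.toMonoidHom, hf.comp e.injective⟩
  obtain ⟨f₄, hf₄⟩ := exists_injective_perm_four K
  obtain ⟨f₅, hf₅⟩ := exists_injective_alternatingGroup_five K
  rcases h with h | ⟨n, hn, ⟨e⟩⟩ | ⟨⟨e⟩⟩ | ⟨⟨e⟩⟩ | ⟨⟨e⟩⟩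
  · have hn : Nat.card G ≠ 0 := Nat.card_pos.ne'
    have := NeZero.mk hn
    have hcard := HasEnoughRootsOfUnity.natCard_rootsOfUnity K (Nat.card G)
    let e : G ≃* rootsOfUnity (Nat.card G) K := mulEquivOfCyclicCardEq hcard.symm
    exact ⟨(homothety K).comp ((Subgroup.subtype _).comp e.toMonoidHom),
      homothety_injective.comp (Subtype.val_injective.comp e.injective)⟩
  · obtain ⟨f, hf⟩ := exists_injective_dihedralGroup K hn
    exact key e hf
  · exact key (f := f₄.comp (alternatingGroup (Fin 4)).subtype) e
      (hf₄.comp Subtype.val_injective)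
  · exact key e hf₄
  · exact key e hf₅

end Embedding

/-! ### Comparison of characteristics -/

theorem nonempty_mulEquiv_multiplicative_zmod {G : Type*} [Group G] [IsCyclic G] {n : ℕ}
    (hn : Nat.card G = n) : Nonempty (G ≃* Multiplicative (ZMod n)) := by
  subst hn
  exact ⟨(zmodCyclicMulEquiv inferInstance).symm⟩

theorem mainTheorem2 (p : ℕ) [Fact p.Prime]
    (k : Type*) [Field k] [IsAlgClosed k] [CharP k p]
    (k₀ : Type*) [Field k₀] [IsAlgClosed k₀] [CharZero k₀]
    (H : Subgroup PGL(2, k)) [Finite H] :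
    (∃ f : H →* PGL(2, k₀), Function.Injective f) ↔
      (¬ p ∣ Nat.card H) ∨
      (p ∣ Nat.card H ∧
        (Nonempty (H ≃* Multiplicative (ZMod p)) ∨
          (p ≠ 2 ∧ Nonempty (H ≃* DihedralGroup p)) ∨
          (p = 2 ∧
            (Nonempty (H ≃* Multiplicative (ZMod 2 × ZMod 2)) ∨
              Nonempty (H ≃* alternatingGroup (Fin 4)) ∨
              ∃ n : ℕ, Odd n ∧ Nonempty (H ≃* DihedralGroup n))) ∨
          (p ≤ 5 ∧ Nonempty (H ≃* alternatingGroup (Fin 5))) ∨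
          (p = 3 ∧
            (Nonempty (H ≃* alternatingGroup (Fin 4)) ∨
              Nonempty (H ≃* Equiv.Perm (Fin 4)))))) := by
  classical
  have hp : p.Prime := Fact.out
  constructor
  · rintro ⟨f, hf⟩
    have hH : IsPolyhedral H := by
      have : Finite f.range := Finite.of_surjective _ f.rangeRestrict_surjective
      exact (isPolyhedral_of_natCard_ne_zero f.range
        (by exact_mod_cast Nat.card_pos.ne')).of_mulEquiv (MonoidHom.ofInjective hf).symm
    by_cases hpH : p ∣ Nat.card H
    swap
    · exact .inl hpH
    refine .inr ⟨hpH, ?_⟩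
    have hord {G : Type} [Group G] (e : H ≃* G) (a : G) (ha : p ∣ orderOf a) : orderOf a = p := by
      rw [← e.symm.orderOf_eq, ← Subgroup.orderOf_coe] at ha ⊢
      refine orderOf_eq_of_charP_dvd p ?_ ha
      rw [Subgroup.orderOf_coe]
      exact (orderOf_pos _).ne'
    rcases hH with h | ⟨n, hn, ⟨e⟩⟩ | ⟨⟨e⟩⟩ | ⟨⟨e⟩⟩ | ⟨⟨e⟩⟩
    · obtain ⟨g, hg⟩ := h.exists_ofOrder_eq_natCard
      rw [← hg, ← Subgroup.orderOf_coe] at hpH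
      refine .inl (nonempty_mulEquiv_multiplicative_zmod ?_)
      rw [← hg, ← Subgroup.orderOf_coe]
      refine orderOf_eq_of_charP_dvd p ?_ hpH
      rw [Subgroup.orderOf_coe]
      exact (orderOf_pos _).ne'
    · rw [Nat.card_congr e.toEquiv, DihedralGroup.nat_card] at hpH
      have hr := hord e (.r 1)
      rw [DihedralGroup.orderOf_r_one] at hr
      by_cases hp2 : p = 2
      · refine .inr (.inr (.inl ⟨hp2, ?_⟩))
        rcases n.even_or_odd with hn2 | hn2
        · obtain rfl : n = 2 := (hr (hp2 ▸ hn2.two_dvd)).trans hp2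
          have hK : Nonempty (DihedralGroup 2 ≃* Multiplicative (ZMod 2 × ZMod 2)) :=
            IsKleinFour.nonempty_mulEquiv
          exact .inl (hK.map e.trans)
        · exact .inr (.inr ⟨n, hn2, ⟨e⟩⟩)
      · have hpn : p ∣ n := (hp.dvd_mul.1 hpH).resolve_left fun h ↦
          hp2 ((Nat.prime_dvd_prime_iff_eq hp Nat.prime_two).1 h)
        obtain rfl := hr hpn
        exact .inr (.inl ⟨hp2, ⟨e⟩⟩)
    · have hcard : 2 * Nat.card H = 24 := by
        rw [Nat.card_congr e.toEquiv, two_mul_nat_card_alternatingGroup, Nat.card_perm,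
          Nat.card_fin]
        rfl
      rw [show Nat.card H = 2 ^ 2 * 3 by omega, hp.dvd_mul] at hpH
      rcases hpH with h | h
      · refine .inr (.inr (.inl ⟨?_, .inr (.inl ⟨e⟩)⟩))
        exact (Nat.prime_dvd_prime_iff_eq hp Nat.prime_two).1 (hp.dvd_of_dvd_pow h)
      · refine .inr (.inr (.inr (.inr ⟨?_, .inl ⟨e⟩⟩)))
        exact (Nat.prime_dvd_prime_iff_eq hp Nat.prime_three).1 h
    · refine .inr (.inr (.inr (.inr ⟨?_, .inr ⟨e⟩⟩)))
      rw [Nat.card_congr e.toEquiv, Nat.card_perm, Nat.card_fin,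
        show Nat.factorial 4 = 2 ^ 3 * 3 from rfl, hp.dvd_mul] at hpH
      refine (Nat.prime_dvd_prime_iff_eq hp Nat.prime_three).1 (hpH.resolve_left fun h ↦ ?_)
      have hp2 := (Nat.prime_dvd_prime_iff_eq hp Nat.prime_two).1 (hp.dvd_of_dvd_pow h)
      -- a cycle of length four has order divisible by two but different from two
      have h4 : orderOf (finRotate 4) = 2 ^ (1 + 1) :=
        orderOf_eq_prime_pow (by decide) (by decide)
      have := hord e (finRotate 4) (by rw [h4, hp2]; norm_num)
      omega
    · have hcard : 2 * Nat.card H = 120 := by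
        rw [Nat.card_congr e.toEquiv, two_mul_nat_card_alternatingGroup, Nat.card_perm,
          Nat.card_fin]
        rfl
      rw [show Nat.card H = 2 ^ 2 * 3 * 5 by omega, hp.dvd_mul, hp.dvd_mul] at hpH
      refine .inr (.inr (.inr (.inl ⟨?_, ⟨e⟩⟩)))
      rcases hpH with (h | h) | h
      · have := Nat.le_of_dvd (by norm_num) (hp.dvd_of_dvd_pow h)
        omega
      · have := Nat.le_of_dvd (by norm_num) h
        omega
      · exact Nat.le_of_dvd (by norm_num) h
  · intro h
    refine IsPolyhedral.exists_injective k₀ ?_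
    rcases h with h | ⟨-, h | ⟨-, h⟩ | ⟨-, ⟨⟨e⟩⟩ | h | ⟨n, hn, h⟩⟩ | ⟨-, h⟩ | ⟨-, h | h⟩⟩
    · exact isPolyhedral_of_natCard_ne_zero H (by rwa [Ne, CharP.cast_eq_zero_iff k p])
    · exact .inl (isCyclic_of_surjective _ h.some.symm.surjective)
    · exact .inr (.inl ⟨p, hp.ne_zero, h⟩)
    · have hK : Nonempty (Multiplicative (ZMod 2 × ZMod 2) ≃* DihedralGroup 2) :=
        IsKleinFour.nonempty_mulEquiv
      exact .inr (.inl ⟨2, two_ne_zero, hK.map e.trans⟩)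
    · exact .inr (.inr (.inl h))
    · exact .inr (.inl ⟨n, hn.pos.ne', h⟩)
    · exact .inr (.inr (.inr (.inr h)))
    · exact .inr (.inr (.inl h))
    · exact .inr (.inr (.inr (.inl h)))
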